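/- Let $A$ be a unital $C^*$-algebra over $\mathbb{C}$. A left ideal of $A$ is said to be of finite order if it can be written as a finite (possibly empty) sum of minimal left ideals of $A$. Let $M$ be a Noetherian left $A$-module of finite presentation, and let $n\in\mathbb{N}_0$. If $M$ is generated by $n$ elements, then there exist left ideals $L_1,\dots,L_n\subseteq A$ of finite order such that $$M\cong L_1\oplus\dots\oplus L_n$$ as left $A$-modules. -/

import Mathlib

open scoped DirectSum

/-- A left ideal is of finite order if it is a finite (possibly empty) sum of minimal left ideals.
For a noncommutative ring, `Ideal A` is the type of left ideals of `A`; a minimal left ideal, i.e.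
a minimal element among the nonzero left ideals, is an atom of this lattice. -/
def Ideal.IsOfFiniteOrder {A : Type*} [Ring A] (L : Ideal A) : Prop :=
  ∃ (k : ℕ) (m : Fin k → Ideal A), (∀ j, IsAtom (m j)) ∧ L = ⨆ j, m j

/-! The core is that a cyclic module `M ≅ A ⧸ I` satisfying the hypotheses is projective. Here `I`
and its closure `J` are both finitely generated, the latter because `J / I` lies in the Noetherian
module `A ⧸ I`. By the open mapping theorem, an `e` that nearly fixes the generators of `J` from the
right makes `x ↦ x * e` nearly the identity on `J`; such `e` exist in `J` by functional calculus,
hence in `I` by density. So `J = J * e ⊆ I`, and inverting this map on `J` yields a retraction of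
`A` onto `I`. All quotients of `M` are then projective too, so `M` is semisimple and embeds in `A`.
Induction on the number of generators gives the general case. -/

/-- A finite family in a unital C⋆-algebra has approximate right units in the left ideal
it generates. -/
theorem CStarAlgebra.exists_mem_span_norm_sub_mul_le {A : Type*} [CStarAlgebra A]
    {m : ℕ} (a : Fin m → A) {ε : ℝ} (hε : 0 < ε) :
    ∃ e ∈ Ideal.span (Set.range a), ∀ i, ‖a i - a i * e‖ ≤ ε := by
  let _ := CStarAlgebra.spectralOrder A
  have := CStarAlgebra.spectralOrderedRing A
  set h : A := ∑ i, star (a i) * a i with hh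
  have h_nonneg : 0 ≤ h := Finset.sum_nonneg fun i _ => star_mul_self_nonneg (a i)
  have h_sa : IsSelfAdjoint h := .of_nonneg h_nonneg
  have h_mem : h ∈ Ideal.span (Set.range a) :=
    Ideal.sum_mem _ fun i _ => Ideal.mul_mem_left _ _ (Ideal.subset_span ⟨i, rfl⟩)
  -- The unit will be `e = (h + δ)⁻¹ * h`, with `r = 1 - e = δ (h + δ)⁻¹`. Since `‖a i * r‖ ^ 2 ≤ ‖r
  -- * h * r‖ ≤ δ`, the choice `δ = ε ^ 2` suffices.
  set δ : ℝ := ε ^ 2 with hδ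
  have δ_pos : 0 < δ := by positivity
  have spec : ∀ t ∈ spectrum ℝ h, 0 ≤ t := fun t ht => spectrum_nonneg_of_nonneg h_nonneg ht
  have ne : ∀ t ∈ spectrum ℝ h, t + δ ≠ 0 := fun t ht => by
    have := spec t ht
    positivity
  have cont : ContinuousOn (fun t : ℝ => (t + δ)⁻¹) (spectrum ℝ h) :=
    ContinuousOn.inv₀ (by fun_prop) ne
  set g : A := cfc (fun t : ℝ => (t + δ)⁻¹) h with hg
  have key : 1 - g * h = cfc (fun t : ℝ => δ * (t + δ)⁻¹) h := by
    have h1 : g * h = cfc (fun t : ℝ => (t + δ)⁻¹ * t) h := by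
      rw [cfc_mul _ _ h cont (by fun_prop), cfc_id' ℝ h]
    rw [h1, ← cfc_one ℝ h, ← cfc_sub (1 : ℝ → ℝ) (fun t : ℝ => (t + δ)⁻¹ * t) h
      continuousOn_const (cont.mul (by fun_prop))]
    refine cfc_congr fun t ht => ?_
    have := ne t ht
    simp only [Pi.one_apply]
    field_simp
    ring
  refine ⟨g * h, Ideal.mul_mem_left _ _ h_mem, fun i => ?_⟩
  set r : A := cfc (fun t : ℝ => δ * (t + δ)⁻¹) h with hr
  have cont' : ContinuousOn (fun t : ℝ => δ * (t + δ)⁻¹) (spectrum ℝ h) :=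
    ContinuousOn.mul (by fun_prop) cont
  have r_sa : star r = r := (IsSelfAdjoint.cfc (R := ℝ)).star_eq
  have e1 : a i - a i * (g * h) = a i * r := by rw [← key]; noncomm_ring
  have e2 : r * h * r = cfc (fun t : ℝ => δ * (t + δ)⁻¹ * t * (δ * (t + δ)⁻¹)) h := by
    rw [cfc_mul (fun t : ℝ => δ * (t + δ)⁻¹ * t) _ h (cont'.mul (by fun_prop)) cont', cfc_mul _ _ h cont' (by fun_prop),
      cfc_id' ℝ h]
  have e3 : ‖r * h * r‖ ≤ δ := by
    rw [e2]
    refine norm_cfc_le δ_pos.le fun t ht => ?_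
    have ht0 := spec t ht
    have : 0 < t + δ := by positivity
    rw [Real.norm_of_nonneg (by positivity)]
    have e : δ * (t + δ)⁻¹ * t * (δ * (t + δ)⁻¹) = δ * (δ * t / (t + δ) ^ 2) := by
      field_simp
    rw [e]
    refine mul_le_of_le_one_right δ_pos.le ?_
    rw [div_le_one (by positivity)]
    nlinarith
  have le : star (a i) * a i ≤ h :=
    Finset.single_le_sum (f := fun j => star (a j) * a j)
      (fun j _ => star_mul_self_nonneg (a j)) (Finset.mem_univ i)
  have e4 : ‖star (a i * r) * (a i * r)‖ ≤ δ := by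
    refine le_trans (CStarAlgebra.norm_le_norm_of_nonneg_of_le (star_mul_self_nonneg _) ?_) e3
    have := star_left_conjugate_le_conjugate le r
    rw [r_sa] at this
    simpa [star_mul, r_sa, mul_assoc] using this
  rw [CStarRing.norm_star_mul_self] at e4
  rw [e1]
  exact abs_le_of_sq_le_sq' (by nlinarith) hε.le |>.2

/-- If right multiplication by `e` is uniformly close to the identity on the generators of a
closed left ideal, then it is close to the identity on the whole ideal. -/
theorem Ideal.exists_norm_sub_mul_le_of_isClosed {A : Type*} [NormedRing A] [NormedAlgebra ℂ A]
    [CompleteSpace A] (J : Ideal A) (hJ : IsClosed (J : Set A)) {m : ℕ} (a : Fin m → A)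
    (ha : Ideal.span (Set.range a) = J) :
    ∃ ε > 0, ∀ e : A, (∀ i, ‖a i - a i * e‖ ≤ ε) → ∀ x ∈ J, ‖x - x * e‖ ≤ ‖x‖ / 2 := by
  let J' : Submodule ℂ A := J.restrictScalars ℂ
  have : CompleteSpace J' := hJ.completeSpace_coe
  have ha_mem (i) : a i ∈ J := ha ▸ Ideal.subset_span ⟨i, rfl⟩
  let f₀ : (Fin m → A) →ₗ[ℂ] A := ∑ i, (LinearMap.mulRight ℂ (a i)) ∘ₗ LinearMap.proj i
  have f₀_apply (y : Fin m → A) : f₀ y = ∑ i, y i * a i := by simp [f₀]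
  have f₀_mem (y : Fin m → A) : f₀ y ∈ J' := by
    rw [f₀_apply]
    exact Ideal.sum_mem _ fun i _ => J.mul_mem_left _ (ha_mem i)
  let f : (Fin m → A) →L[ℂ] J' :=
    ⟨f₀.codRestrict J' f₀_mem, by
      refine Continuous.subtype_mk ?_ _
      have : (fun y => f₀ y) = fun y : Fin m → A => ∑ i, y i * a i := funext f₀_apply
      change Continuous (fun y => f₀ y)
      rw [this]
      fun_prop⟩
  have f_surj : Function.Surjective f := by
    rintro ⟨x, hx⟩
    have hx' : x ∈ Submodule.span A (Set.range a) := by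
      change x ∈ Ideal.span (Set.range a)
      rw [ha]
      exact hx
    obtain ⟨y, hy⟩ := (Submodule.mem_span_range_iff_exists_fun A).1 hx'
    exact ⟨y, Subtype.ext ((f₀_apply y).trans hy)⟩
  obtain ⟨C, hC, hf⟩ := f.exists_preimage_norm_le f_surj
  -- The `+ 1` keeps the denominator nonzero when `m = 0`.
  refine ⟨1 / (2 * (m * C + 1)), by positivity, fun e he x hx => ?_⟩
  obtain ⟨y, hy, hyx⟩ := hf ⟨x, hx⟩
  have hy' : ∑ i, y i * a i = x := (f₀_apply y).symm.trans (congrArg Subtype.val hy)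
  have hyx' : ‖y‖ ≤ C * ‖x‖ := hyx
  have e1 : x - x * e = ∑ i, y i * (a i - a i * e) := by
    rw [← hy', Finset.sum_mul, ← Finset.sum_sub_distrib]
    exact Finset.sum_congr rfl fun i _ => by noncomm_ring
  rw [e1]
  calc ‖∑ i, y i * (a i - a i * e)‖
      ≤ ∑ i : Fin m, (C * ‖x‖) * (1 / (2 * (m * C + 1))) :=
        norm_sum_le_of_le _ fun i _ => (norm_mul_le _ _).trans <|
          mul_le_mul ((norm_le_pi_norm y i).trans hyx') (he i) (norm_nonneg _) (by positivity)
    _ = (m * C / (m * C + 1)) * (‖x‖ / 2) := by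
        simp only [Finset.sum_const, Finset.card_univ, Fintype.card_fin, nsmul_eq_mul]
        field_simp
    _ ≤ ‖x‖ / 2 := by
        refine mul_le_of_le_one_left (by positivity) ?_
        rw [div_le_one (by positivity)]
        linarith

/-- Right multiplication by an element of a left ideal, as an endomorphism of that ideal. -/
def Ideal.mulRightEnd {A : Type*} [Ring A] (J : Ideal A) (e : A) (he : e ∈ J) : A →ₗ[A] J :=
  (LinearMap.toSpanSingleton A A e).codRestrict J fun x => J.mul_mem_left x he

theorem ContinuousLinearMap.bijective_sub_of_norm_lt_one {E : Type*} [NormedAddCommGroup E]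
    [NormedSpace ℂ E] [CompleteSpace E] (S : E →L[ℂ] E) (hS : ‖S‖ < 1) :
    Function.Bijective fun x => x - S x :=
  ContinuousLinearMap.isUnit_iff_bijective.1 (isUnit_one_sub_of_norm_lt_one hS)

/-- The map differs from the identity of the Banach space `J` by an operator of norm at most `1 /
2`, so a Neumann series inverts it. -/
theorem Ideal.bijective_mulRightEnd_of_norm_sub_mul_le {A : Type*} [NormedRing A]
    [NormedAlgebra ℂ A] [CompleteSpace A] (J : Ideal A) (hJ : IsClosed (J : Set A)) (e : A)
    (he : e ∈ J) (h : ∀ x ∈ J, ‖x - x * e‖ ≤ ‖x‖ / 2) :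
    Function.Bijective (J.mulRightEnd e he ∘ₗ J.subtype) := by
  let J' : Submodule ℂ A := J.restrictScalars ℂ
  have : CompleteSpace J' := hJ.completeSpace_coe
  let S₀ : J' →ₗ[ℂ] J' :=
    { toFun := fun x => ⟨x - x * e, J.sub_mem x.2 (J.mul_mem_left _ he)⟩
      map_add' := fun x y => Subtype.ext (by simp only [Submodule.coe_add]; noncomm_ring)
      map_smul' := fun c x => Subtype.ext (by simp [smul_sub]) }
  let S : J' →L[ℂ] J' := S₀.mkContinuous (1 / 2) fun x => by
    have := h x x.2
    calc ‖S₀ x‖ = ‖(x : A) - x * e‖ := rfl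
      _ ≤ ‖(x : A)‖ / 2 := this
      _ = 1 / 2 * ‖x‖ := by rw [Submodule.coe_norm]; ring
  have hS : ‖S‖ < 1 := (S₀.mkContinuous_norm_le (by norm_num) _).trans_lt (by norm_num)
  have heq : (fun x : J' => x - S x) = (J.mulRightEnd e he ∘ₗ J.subtype : J → J) := by
    funext x
    refine Subtype.ext ?_
    change (x : A) - (x - x * e) = x * e
    abel
  have hb := S.bijective_sub_of_norm_lt_one hS
  rw [heq] at hb
  exact hb

/-- A finitely generated left ideal of a unital C⋆-algebra whose closure is also
finitely generated is a direct summand. -/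
theorem Ideal.exists_isCompl_of_fg_closure {A : Type*} [CStarAlgebra A] (I : Ideal A)
    (hI : I.closure.FG) : ∃ C : Ideal A, IsCompl I C := by
  set J := I.closure with hJ
  have hIJ : I ≤ J := fun x hx => subset_closure hx
  have hJc : IsClosed (J : Set A) := by rw [hJ, Ideal.coe_closure]; exact isClosed_closure
  obtain ⟨m, a, ha⟩ := Submodule.fg_iff_exists_fin_generating_family.1 hI
  obtain ⟨ε, hε, H⟩ := J.exists_norm_sub_mul_le_of_isClosed hJc a ha
  obtain ⟨e₀, he₀, h₀⟩ :=
    CStarAlgebra.exists_mem_span_norm_sub_mul_le a (half_pos hε)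
  have he₀J : e₀ ∈ closure (I : Set A) := by
    rw [← Ideal.coe_closure, ← hJ, ← ha]
    exact he₀
  set K : ℝ := ∑ i, ‖a i‖ with hK
  have hK0 : 0 ≤ K := Finset.sum_nonneg fun i _ => norm_nonneg _
  -- Moving `e₀` into `I` itself costs at most the other `ε / 2` on each generator.
  obtain ⟨e, heI, he⟩ := Metric.mem_closure_iff.1 he₀J (ε / (2 * (K + 1))) (by positivity)
  have hclose (i) : ‖a i - a i * e‖ ≤ ε := by
    have hi : ‖a i‖ ≤ K := Finset.single_le_sum (f := fun j => ‖a j‖)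
      (fun j _ => norm_nonneg _) (Finset.mem_univ i)
    rw [dist_eq_norm] at he
    calc ‖a i - a i * e‖ = ‖(a i - a i * e₀) + a i * (e₀ - e)‖ := by congr 1; noncomm_ring
      _ ≤ ε / 2 + K * (ε / (2 * (K + 1))) :=
        (norm_add_le _ _).trans <| add_le_add (h₀ i) <| (norm_mul_le _ _).trans <|
          mul_le_mul hi he.le (norm_nonneg _) hK0
      _ ≤ ε / 2 + ε / 2 := by
        have : K * (ε / (2 * (K + 1))) = (K / (K + 1)) * (ε / 2) := by field_simp
        rw [this]
        gcongr
        refine mul_le_of_le_one_left (by positivity) ?_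
        rw [div_le_one (by positivity)]
        linarith
      _ = ε := add_halves ε
  have hb := J.bijective_mulRightEnd_of_norm_sub_mul_le hJc e (hIJ heI) (H e hclose)
  have hIeq : I = J := by
    refine le_antisymm hIJ fun x hx => ?_
    obtain ⟨y, hy⟩ := hb.2 ⟨x, hx⟩
    have : (y : A) * e = x := congrArg Subtype.val hy
    exact this ▸ I.mul_mem_left _ heI
  let R : J ≃ₗ[A] J := LinearEquiv.ofBijective _ hb
  rw [hIeq]
  refine ⟨_, LinearMap.isCompl_of_proj (f := R.symm.toLinearMap ∘ₗ J.mulRightEnd e (hIJ heI))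
    fun x => ?_⟩
  exact R.symm_apply_apply x

/-- The closure of `I` is an extension of its finitely generated image in `A ⧸ I` by `I`. -/
theorem Ideal.exists_isCompl_of_isNoetherian_quotient {A : Type*} [CStarAlgebra A] (I : Ideal A)
    (hI : I.FG) [IsNoetherian A (A ⧸ I)] : ∃ C : Ideal A, IsCompl I C := by
  refine I.exists_isCompl_of_fg_closure ?_
  refine Submodule.fg_of_fg_map_of_fg_inf_ker (Submodule.mkQ I) (IsNoetherian.noetherian _) ?_
  rw [Submodule.ker_mkQ, inf_eq_right.2 fun x hx => subset_closure hx]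
  exact hI

theorem Submodule.exists_isCompl_of_projective_quotient {R M : Type*} [Ring R] [AddCommGroup M]
    [Module R M] (K : Submodule R M) [Module.Projective R (M ⧸ K)] :
    ∃ C : Submodule R M, IsCompl K C := by
  obtain ⟨s, hs⟩ := Module.projective_lifting_property K.mkQ LinearMap.id K.mkQ_surjective
  have hs' (q) : K.mkQ (s q) = q := LinearMap.congr_fun hs q
  let p : M →ₗ[R] K := (LinearMap.id - s ∘ₗ K.mkQ).codRestrict K fun m => by
    refine (Submodule.Quotient.mk_eq_zero K).1 ?_
    change K.mkQ _ = 0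
    simp only [LinearMap.sub_apply, LinearMap.comp_apply, LinearMap.id_apply, map_sub, hs', sub_self]
  refine ⟨_, LinearMap.isCompl_of_proj (f := p) fun x => Subtype.ext ?_⟩
  have : K.mkQ x = 0 := (Submodule.Quotient.mk_eq_zero K).2 x.2
  change (x : M) - s (K.mkQ x) = x
  rw [this, map_zero, sub_zero]

theorem Module.Projective.of_isCompl_quotient {R M : Type*} [Ring R] [AddCommGroup M]
    [Module R M] [Module.Projective R M] {K C : Submodule R M} (h : IsCompl K C) :
    Module.Projective R (M ⧸ K) := by
  have : Module.Projective R C :=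
    .of_split C.subtype (C.projectionOnto K h.symm)
      (LinearMap.ext fun x => C.projectionOnto_apply_left h.symm x)
  exact .of_equiv (K.quotientEquivOfIsCompl C h).symm

/-- A Noetherian finitely presented cyclic module over a unital C⋆-algebra is projective. -/
theorem Module.projective_of_isNoetherian_of_span_singleton {A : Type*} [CStarAlgebra A]
    {M : Type*} [AddCommGroup M] [Module A M] [IsNoetherian A M] [Module.FinitePresentation A M]
    (x : M) (hx : Submodule.span A {x} = ⊤) : Module.Projective A M := by
  let f := LinearMap.toSpanSingleton A M x
  have hf : Function.Surjective f := by
    rw [← LinearMap.range_eq_top, LinearMap.range_toSpanSingleton, hx]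
  let I : Ideal A := LinearMap.ker f
  let e : (A ⧸ I) ≃ₗ[A] M := f.quotKerEquivOfSurjective hf
  have : IsNoetherian A (A ⧸ I) := isNoetherian_of_linearEquiv e.symm
  obtain ⟨C, hC⟩ := I.exists_isCompl_of_isNoetherian_quotient
    (Module.FinitePresentation.fg_ker f hf)
  have : Module.Projective A (A ⧸ I) := .of_isCompl_quotient hC
  exact .of_equiv e

/-- Each quotient `M ⧸ K` is again cyclic, Noetherian and finitely presented, hence projective, so
`K` splits off. -/
theorem IsSemisimpleModule.of_isNoetherian_of_span_singleton {A : Type*} [CStarAlgebra A]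
    {M : Type*} [AddCommGroup M] [Module A M] [IsNoetherian A M] [Module.FinitePresentation A M]
    (x : M) (hx : Submodule.span A {x} = ⊤) : IsSemisimpleModule A M := by
  refine (isSemisimpleModule_iff A M).2 ⟨fun K => ?_⟩
  have : Module.FinitePresentation A (M ⧸ K) :=
    Module.finitePresentation_of_surjective K.mkQ K.mkQ_surjective (IsNoetherian.noetherian _)
  have : Module.Projective A (M ⧸ K) :=
    Module.projective_of_isNoetherian_of_span_singleton (K.mkQ x) <| by
      rw [← Set.image_singleton, ← Submodule.map_span, hx, Submodule.map_top, K.range_mkQ]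
  exact K.exists_isCompl_of_projective_quotient

/-- `L` is the supremum of its minimal left ideals; being finitely generated, it is compact in the
lattice, so finitely many suffice. -/
theorem Ideal.IsOfFiniteOrder.of_isSemisimpleModule {R : Type*} [Ring R] (L : Ideal R)
    [IsSemisimpleModule R L] (hL : L.FG) : L.IsOfFiniteOrder := by
  have hc : IsCompactElement L := (Submodule.fg_iff_compact L).1 hL
  let T := { m : Submodule R L // IsSimpleModule R m }
  have hT' : ⨆ m : T, m.1 = ⊤ :=
    (sSup_eq_iSup' _).symm.trans (IsSemisimpleModule.sSup_simples_eq_top R L)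
  have hT : ⨆ m : T, m.1.map L.subtype = L := by
    rw [← Submodule.map_iSup, hT', Submodule.map_top, Submodule.range_subtype]
  have hatom (m : T) : IsAtom (m.1.map L.subtype) := by
    have := m.2
    rw [← isSimpleModule_iff_isAtom]
    exact .congr (m.1.equivMapOfInjective L.subtype L.injective_subtype).symm
  obtain ⟨s, hs⟩ := CompleteLattice.IsCompactElement.exists_finset_of_le_iSup _ hc
    (fun m : T => m.1.map L.subtype) hT.ge
  refine ⟨s.card, fun j => (s.equivFin.symm j).1.1.map L.subtype, fun j => hatom _,
    le_antisymm ?_ (iSup_le fun j => Submodule.map_subtype_le _ _)⟩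
  refine hs.trans (iSup₂_le fun m hm => ?_)
  refine le_trans ?_ (le_iSup _ (s.equivFin ⟨m, hm⟩))
  dsimp only
  rw [Equiv.symm_apply_apply]

/-- A Noetherian finitely presented cyclic module over a unital C⋆-algebra is isomorphic to a
left ideal of finite order. -/
theorem Ideal.IsOfFiniteOrder.exists_linearEquiv {A : Type*} [CStarAlgebra A]
    {M : Type*} [AddCommGroup M] [Module A M] [IsNoetherian A M] [Module.FinitePresentation A M]
    (x : M) (hx : Submodule.span A {x} = ⊤) :
    ∃ L : Ideal A, L.IsOfFiniteOrder ∧ Nonempty (M ≃ₗ[A] L) := by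
  have := Module.projective_of_isNoetherian_of_span_singleton x hx
  have := IsSemisimpleModule.of_isNoetherian_of_span_singleton x hx
  have hf : Function.Surjective (LinearMap.toSpanSingleton A M x) := by
    rw [← LinearMap.range_eq_top, LinearMap.range_toSpanSingleton, hx]
  obtain ⟨s, hs⟩ := Module.projective_lifting_property _ LinearMap.id hf
  let e : M ≃ₗ[A] LinearMap.range s :=
    LinearEquiv.ofInjective s
      (Function.LeftInverse.injective (g := LinearMap.toSpanSingleton A M x)
        (LinearMap.congr_fun hs))
  have : IsSemisimpleModule A (LinearMap.range s) := e.symm.isSemisimpleModule_iff.2 ‹_›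
  have : IsNoetherian A (LinearMap.range s) := isNoetherian_of_linearEquiv e
  exact ⟨LinearMap.range s, .of_isSemisimpleModule _ (isNoetherian_submodule.1 this _ le_rfl), ⟨e⟩⟩

/-- Modulo the span `N` of all generators but the first, `M` becomes cyclic, hence projective; so
`M` is the sum of that quotient and `N`, and induction applies to `N`. -/
theorem Ideal.IsOfFiniteOrder.exists_linearEquiv_pi {A : Type*} [CStarAlgebra A] (n : ℕ) :
    ∀ {M : Type*} [AddCommGroup M] [Module A M] [IsNoetherian A M]
      [Module.FinitePresentation A M] (x : Fin n → M), Submodule.span A (Set.range x) = ⊤ →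
      ∃ L : Fin n → Ideal A, (∀ i, (L i).IsOfFiniteOrder) ∧ Nonempty (M ≃ₗ[A] ∀ i, L i) := by
  induction n with
  | zero =>
    intro M _ _ _ _ x hx
    have : Subsingleton M := by
      rw [Set.range_eq_empty, Submodule.span_empty] at hx
      exact (Submodule.subsingleton_iff A).1 (subsingleton_of_bot_eq_top hx)
    exact ⟨fun i => i.elim0, fun i => i.elim0, ⟨0⟩⟩
  | succ n ih =>
    intro M _ _ _ _ x hx
    let N : Submodule A M := Submodule.span A (Set.range (x ∘ Fin.succ))
    have hspan : Submodule.span A {N.mkQ (x 0)} = ⊤ := by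
      rw [← Set.image_singleton, ← Submodule.map_span, Submodule.map_mkQ_eq_top,
        ← Submodule.span_union, ← hx]
      congr 1
      rw [Fin.range_fin_succ, Set.union_comm, Set.singleton_union]
      rfl
    have : Module.FinitePresentation A (M ⧸ N) :=
      Module.finitePresentation_of_surjective N.mkQ N.mkQ_surjective (IsNoetherian.noetherian _)
    obtain ⟨L₀, hL₀, ⟨e₀⟩⟩ := exists_linearEquiv (N.mkQ (x 0)) hspan
    have := Module.projective_of_isNoetherian_of_span_singleton (N.mkQ (x 0)) hspan
    obtain ⟨C, hC⟩ := N.exists_isCompl_of_projective_quotient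
    -- As a direct summand, `N` is a quotient of `M` by the finitely generated `C`.
    have : Module.FinitePresentation A N :=
      Module.finitePresentation_of_surjective (N.projectionOnto C hC)
        (N.projectionOnto_surjective hC) (IsNoetherian.noetherian _)
    obtain ⟨L, hL, ⟨e⟩⟩ := ih
      (fun i => (⟨x i.succ, Submodule.subset_span ⟨i, rfl⟩⟩ : N)) (by
        refine Submodule.map_injective_of_injective N.injective_subtype ?_
        rw [Submodule.map_span, Submodule.map_top, Submodule.range_subtype, ← Set.range_comp]
        rfl)
    refine ⟨Fin.cons L₀ L, Fin.cases hL₀ hL, ⟨?_⟩⟩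
    exact (C.prodEquivOfIsCompl N hC.symm).symm ≪≫ₗ
      LinearEquiv.prodCongr ((N.quotientEquivOfIsCompl C hC).symm ≪≫ₗ e₀) e ≪≫ₗ
      Fin.consLinearEquiv A (fun i => ((Fin.cons L₀ L : Fin (n + 1) → Ideal A) i : Type _))

theorem mainTheorem12 {A : Type*} [CStarAlgebra A] {M : Type*} [AddCommGroup M] [Module A M]
    [IsNoetherian A M] [Module.FinitePresentation A M]
    (n : ℕ) (x : Fin n → M) (hx : Submodule.span A (Set.range x) = ⊤) :
    ∃ L : Fin n → Ideal A, (∀ i, (L i).IsOfFiniteOrder) ∧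
      Nonempty (M ≃ₗ[A] ⨁ i, L i) := by
  obtain ⟨L, hL, ⟨e⟩⟩ := Ideal.IsOfFiniteOrder.exists_linearEquiv_pi n x hx
  exact ⟨L, hL, ⟨e ≪≫ₗ (DirectSum.linearEquivFunOnFintype A (Fin n) fun i => L i).symm⟩⟩
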